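/- Let $(W,S)$ be a finite Coxeter system with length function $\ell$. For $I\subseteq S$ let $W_I$ be the subgroup generated by $I$, let $w_{\circ,I}$ be its longest element, put $w_\circ=w_{\circ,S}$, and let $W^I=\{w\in W:\ \ell(ws)>\ell(w)\text{ for all }s\in I\}$. A standard parabolic coset is a subset of $W$ of the form $xW_I$ with $I\subseteq S$ and $x\in W$; each of them can be written with $x\in W^I$. The (right) facial weak order $\le$ on the set of all standard parabolic cosets is the reflexive transitive closure of the relations, for $I\subseteq S$ and $x\in W^I$, $$\text{(1)}\quad xW_I\lessdot xW_{I\cup\{s\}}\quad\text{if } s\in S\setminus I \text{ and } x\in W^{I\cup\{s\}},$$ $$\text{(2)}\quad xW_I\lessdot x\,w_{\circ,I}\,w_{\circ,I\setminus\{s\}}W_{I\setminus\{s\}}\quad\text{if } s\in I.$$ **Proposition 3.7.** The maps given, for $I\subseteq S$ and $x\in W^I$, by $$xW_I\longmapsto w_\circ x w_{\circ,I}\,W_I\qquad\text{and}\qquad xW_I\longmapsto x w_{\circ,I} w_\circ\, W_{w_\circ I w_\circ}$$ are well-defined anti-automorphisms of the facial weak order, that is, bijections $\varphi$ of the set of standard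 parabolic cosets onto itself with $C\le D\iff \varphi(D)\le\varphi(C)$ for all $C,D$. Consequently, the map $$xW_I\longmapsto w_\circ x w_\circ\, W_{w_\circ I w_\circ}\qquad(I\subseteq S,\ x\in W^I)$$ is a well-defined automorphism of the facial weak order. Here $w_\circ I w_\circ=\{w_\circ s w_\circ: s\in I\}\subseteq S$, and the images are written with their minimal length representatives: $w_\circ x w_{\circ,I}\in W^I$, and both $x w_{\circ,I}w_\circ$ and $w_\circ x w_\circ$ lie in $W^{w_\circ I w_\circ}$. -/

import Mathlib

namespace FacialWeakOrder

open scoped Pointwise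

variable {B W : Type*} [Group W] {M : CoxeterMatrix B} (cs : CoxeterSystem M W)

/-- The set `S ⊆ W` of simple generators. -/
def simples : Set W := Set.range cs.simple

/-- The set `W^I` of elements with no right descent in `I`: the `w` with `ℓ(ws) > ℓ(w)` for all
`s ∈ I`. -/
def minReps (I : Set W) : Set W := {w | ∀ s ∈ I, cs.length w < cs.length (w * s)}

/-- In a finite group, the subgroup `W_I` generated by `I` has an element of maximal length. -/
theorem exists_longest [Finite W] (I : Set W) :
    ∃ w ∈ Subgroup.closure I, ∀ v ∈ Subgroup.closure I, cs.length v ≤ cs.length w :=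
  Set.exists_max_image (Subgroup.closure I : Set W) cs.length (Set.toFinite _)
    ⟨1, (Subgroup.closure I).one_mem⟩

/-- The longest element `w_{∘,I}` of the parabolic subgroup `W_I = ⟨I⟩`. -/
noncomputable def longest [Finite W] (I : Set W) : W :=
  (exists_longest cs I).choose

/-- The longest element `w_∘` of `W`. -/
noncomputable def wo [Finite W] : W := longest cs (simples cs)

theorem longest_mem [Finite W] (I : Set W) : longest cs I ∈ Subgroup.closure I :=
  (exists_longest cs I).choose_spec.1

theorem length_le_longest [Finite W] (I : Set W) {v : W} (hv : v ∈ Subgroup.closure I) :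
    cs.length v ≤ cs.length (longest cs I) :=
  (exists_longest cs I).choose_spec.2 v hv

/-- The set `w_∘ I w_∘ = {w_∘ s w_∘ : s ∈ I}`. -/
def conjWo [Finite W] (I : Set W) : Set W := (fun s => wo cs * s * wo cs) '' I

/-- The set of faces of the Coxeter complex of `(W, S)`: the standard parabolic cosets `x W_I`
with `I ⊆ S` and `x ∈ W`, as subsets of `W`. -/
def CoxeterComplex : Type _ :=
  {C : Set W // ∃ I ⊆ simples cs, ∃ x : W, C = x • (Subgroup.closure I : Set W)}

/-- The standard parabolic coset `x W_I`, for `I ⊆ S`. -/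
def face (x : W) (I : Set W) (hI : I ⊆ simples cs) : CoxeterComplex cs :=
  ⟨x • (Subgroup.closure I : Set W), I, hI, x, rfl⟩

/-- The two types of generating (cover) relations of the right facial weak order, for `I ⊆ S` and
`x ∈ W^I`:
(1) `x W_I ⋖ x W_{I ∪ {s}}` if `s ∈ S`, `s ∉ I` and `x ∈ W^{I ∪ {s}}`;
(2) `x W_I ⋖ x w_{∘,I} w_{∘,I∖{s}} W_{I∖{s}}` if `s ∈ I`. -/
inductive FacialCover [Finite W] : CoxeterComplex cs → CoxeterComplex cs → Prop
  | up (x : W) (I : Set W) (s : W) (hI : I ⊆ simples cs) (hx : x ∈ minReps cs I)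
      (hs : s ∈ simples cs) (hsI : s ∉ I) (hxs : x ∈ minReps cs (insert s I)) :
      FacialCover (face cs x I hI) (face cs x (insert s I) (Set.insert_subset hs hI))
  | down (x : W) (I : Set W) (s : W) (hI : I ⊆ simples cs) (hx : x ∈ minReps cs I)
      (hsI : s ∈ I) :
      FacialCover (face cs x I hI)
        (face cs (x * longest cs I * longest cs (I \ {s})) (I \ {s})
          (Set.sdiff_subset.trans hI))

/-- The right facial weak order: the reflexive transitive closure of the cover relations. -/
instance instPreorder [Finite W] : Preorder (CoxeterComplex cs) where
  le := Relation.ReflTransGen (FacialCover cs)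
  le_refl _ := Relation.ReflTransGen.refl
  le_trans _ _ _ := Relation.ReflTransGen.trans

end FacialWeakOrder

/-! Define the maps on cosets as sets, `C ↦ w∘C` and `C ↦ w∘Cw∘`, so that well-definedness is
automatic and both are involutions. Left translation by `w∘` reverses length, so it interchanges
cover types (1) and (2) and reverses arrows; conjugation by `w∘` preserves length and permutes `S`,
so it preserves each type. The second anti-automorphism is their composite, `C ↦ Cw∘`. All length
facts come from `length_mul_add_of_forall_descent`, which rests on the exchange property. -/

namespace FacialWeakOrder

open scoped Pointwise

/-! ### The exchange property, via signed reflections -/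

section Exchange

variable {B W : Type*} [Group W] {M : CoxeterMatrix B} (cs : CoxeterSystem M W)

open Classical in
/-- The action of a simple reflection on `W × ZMod 2`: conjugation on the first factor, and a
change of sign exactly at the reflection itself. -/
noncomputable def signedConj (i : B) : Function.End (W × ZMod 2) := fun p =>
  (cs.simple i * p.1 * cs.simple i, p.2 + if p.1 = cs.simple i then 1 else 0)

theorem pow_mul_eq_mul_inv_pow {a b : W} (ha : a * a = 1) (hb : b * b = 1) (n : ℕ) :
    b * (a * b) ^ n = ((a * b) ^ n)⁻¹ * b := by
  have ha' : a⁻¹ = a := inv_eq_of_mul_eq_one_left ha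
  have hb' : b⁻¹ = b := inv_eq_of_mul_eq_one_left hb
  have h : SemiconjBy b (a * b) (a * b)⁻¹ := by
    simp [SemiconjBy, mul_inv_rev, ha', hb', mul_assoc]
  have := (h.pow_right n).eq
  rwa [inv_pow] at this

-- Each factor `s_i s_j` tests two reflections; pulled back to `p.1`, they are the alternating words
-- `b(ab)^(2n)` and `b(ab)^(2n+1)`.
open Classical in
theorem signedConj_mul_pow (i j : B) (n : ℕ) (p : W × ZMod 2) :
    ((signedConj cs i * signedConj cs j) ^ n) p =
      ((cs.simple i * cs.simple j) ^ n * p.1 * ((cs.simple i * cs.simple j) ^ n)⁻¹,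
        p.2 + ∑ k ∈ Finset.range (2 * n),
          if p.1 = cs.simple j * (cs.simple i * cs.simple j) ^ k then (1 : ZMod 2) else 0) := by
  have ha := cs.simple_mul_simple_self i
  have hb := cs.simple_mul_simple_self j
  have hc := pow_mul_eq_mul_inv_pow ha hb
  have ha' := cs.inv_simple i
  have hb' := cs.inv_simple j
  generalize hA : cs.simple i = a at *
  generalize hB : cs.simple j = b at *
  induction n with
  | zero => simp [Function.End.one_def]
  | succ n ih =>
    rw [pow_succ']
    have e : ∀ (f g h : Function.End (W × ZMod 2)), (f * g * h) p = f (g (h p)) :=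
      fun _ _ _ => rfl
    rw [e, ih]
    simp only [signedConj, hA, hB]
    have h1 : ((a * b) ^ n * p.1 * ((a * b) ^ n)⁻¹ = b) ↔ p.1 = b * (a * b) ^ (2 * n) := by
      rw [two_mul, pow_add, ← mul_assoc, hc, mul_inv_eq_iff_eq_mul, mul_assoc,
        ← eq_inv_mul_iff_mul_eq]
    have flip : ∀ q, b * q * b = a ↔ q = b * a * b := fun q => by
      constructor <;> intro h
      · rw [← h]
        simp only [mul_assoc, hb, mul_one]
        simp [← mul_assoc, hb]
      · rw [h]
        simp only [mul_assoc, hb, mul_one]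
        simp [← mul_assoc, hb]
    have h2 : (b * ((a * b) ^ n * p.1 * ((a * b) ^ n)⁻¹) * b = a) ↔
        p.1 = b * (a * b) ^ (2 * n + 1) := by
      have h3 : b * (a * b) ^ (2 * n + 1) =
          ((a * b) ^ n)⁻¹ * (b * a * b) * (a * b) ^ n := by
        have : 2 * n + 1 = n + (1 + n) := by ring
        rw [this, pow_add, ← mul_assoc, hc, pow_add, pow_one]
        simp only [mul_assoc]
      rw [h3, flip, mul_inv_eq_iff_eq_mul, ← eq_inv_mul_iff_mul_eq, ← mul_assoc]
    refine Prod.ext ?_ ?_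
    · simp [pow_succ', mul_assoc, ha', hb']
    · rw [show 2 * (n + 1) = 2 * n + 1 + 1 by ring, Finset.sum_range_succ, Finset.sum_range_succ]
      simp only [h1, h2, add_assoc]

theorem signedConj_isLiftable : M.IsLiftable (signedConj cs) := by
  classical
  intro i j
  funext p
  rw [signedConj_mul_pow]
  have h := cs.simple_mul_simple_pow i j
  -- Since `(s_i s_j)^m = 1`, the terms `k` and `k + m` agree and cancel modulo two.
  simp only [h, two_mul, Finset.sum_range_add, pow_add, one_mul, CharTwo.add_self_eq_zero]
  simp [Function.End.one_def]

/-- The action of `W` on `W × ZMod 2` which on reflections counts inversions modulo two. -/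
noncomputable def signedConjHom : W →* Function.End (W × ZMod 2) :=
  cs.lift ⟨signedConj cs, signedConj_isLiftable cs⟩

-- The left side depends only on the product of the word, hence so does the parity of each count in
-- its right inversion sequence.
open Classical in
theorem signedConjHom_wordProd (ω : List B) (p : W × ZMod 2) :
    signedConjHom cs (cs.wordProd ω) p =
      (cs.wordProd ω * p.1 * (cs.wordProd ω)⁻¹, p.2 + ((cs.rightInvSeq ω).count p.1 : ℕ)) := by
  induction ω with
  | nil => simp [Function.End.one_def]
  | cons i ω ih =>
    have e : ∀ (f g : Function.End (W × ZMod 2)), (f * g) p = f (g p) := fun _ _ => rfl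
    rw [cs.wordProd_cons, map_mul, e, ih, signedConjHom, cs.lift_apply_simple, signedConj]
    refine Prod.ext ?_ ?_
    · simp [mul_assoc]
    · have h : (cs.wordProd ω * p.1 * (cs.wordProd ω)⁻¹ = cs.simple i) ↔
          ((cs.wordProd ω)⁻¹ * cs.simple i * cs.wordProd ω = p.1) := by
        rw [mul_inv_eq_iff_eq_mul, ← eq_inv_mul_iff_mul_eq, mul_assoc, eq_comm]
      simp only [CoxeterSystem.rightInvSeq, List.count_cons, h, beq_iff_eq]
      split_ifs <;> simp [add_assoc]

/-- If `ℓ(ws) < ℓ(w)` then `s` occurs in the right inversion sequence of every word for `w`. -/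
theorem simple_mem_rightInvSeq {ω : List B} {i : B}
    (h : cs.length (cs.wordProd ω * cs.simple i) < cs.length (cs.wordProd ω)) :
    cs.simple i ∈ cs.rightInvSeq ω := by
  classical
  by_contra hn
  obtain ⟨ω', hr, hω'⟩ := cs.exists_isReduced (cs.wordProd ω * cs.simple i)
  have e : ∀ (f g : Function.End (W × ZMod 2)) p, (f * g) p = f (g p) := fun _ _ _ => rfl
  -- As `s` sends `(s, 0)` to `(s, 1)`, the counts of `s` for `ω` and for `ω'` have opposite parity.
  -- If `s` is absent from the first, it is a right inversion of `ws`, against `ℓ(ws) < ℓ(w)`.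
  have h1 := signedConjHom_wordProd cs ω' (cs.simple i, 0)
  have h2 : signedConjHom cs (cs.simple i) (cs.simple i, 0) = (cs.simple i, 1) := by
    rw [signedConjHom, cs.lift_apply_simple, signedConj]
    simp
  rw [← hω', map_mul, e, h2, signedConjHom_wordProd, List.count_eq_zero_of_not_mem hn] at h1
  have h3 : cs.simple i ∈ cs.rightInvSeq ω' := by
    by_contra h3
    have := congrArg Prod.snd h1
    simp [List.count_eq_zero_of_not_mem h3] at this
  have h4 := (cs.isRightInversion_of_mem_rightInvSeq hr h3).2
  rw [← hω', mul_assoc, cs.simple_mul_simple_self, mul_one] at h4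
  omega

/-- The exchange property. -/
theorem exchange {ω : List B} {i : B}
    (h : cs.length (cs.wordProd ω * cs.simple i) < cs.length (cs.wordProd ω)) :
    ∃ j < ω.length, cs.wordProd ω * cs.simple i = cs.wordProd (ω.eraseIdx j) := by
  obtain ⟨j, hj, hji⟩ := List.mem_iff_getElem.mp (simple_mem_rightInvSeq cs h)
  refine ⟨j, by simpa using hj, ?_⟩
  rw [← cs.wordProd_mul_getD_rightInvSeq, List.getD_eq_getElem _ _ hj, hji]

end Exchange

/-! ### Lengths, longest elements and minimal representatives in parabolic subgroups -/

section Parabolic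

variable {B W : Type*} [Group W] {M : CoxeterMatrix B} (cs : CoxeterSystem M W)

/-- Every element of a standard parabolic subgroup `W_I` has a reduced word with letters in
`I`. -/
theorem exists_reduced_word_of_mem_closure {I : Set W} (hI : I ⊆ simples cs) {v : W}
    (hv : v ∈ Subgroup.closure I) :
    ∃ ω : List B, cs.IsReduced ω ∧ v = cs.wordProd ω ∧ ∀ i ∈ ω, cs.simple i ∈ I := by
  have step : ∀ v, ∀ s ∈ I, (∃ ω : List B, cs.IsReduced ω ∧ v = cs.wordProd ω ∧
      ∀ i ∈ ω, cs.simple i ∈ I) → ∃ ω : List B, cs.IsReduced ω ∧ v * s = cs.wordProd ω ∧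
      ∀ i ∈ ω, cs.simple i ∈ I := by
    rintro v s hs ⟨ω, hr, rfl, hω⟩
    obtain ⟨i, rfl⟩ := hI hs
    rcases cs.length_mul_simple (cs.wordProd ω) i with h | h
    · refine ⟨ω ++ [i], ?_, by simp [cs.wordProd_append], ?_⟩
      · rw [CoxeterSystem.IsReduced, cs.wordProd_append, cs.wordProd_singleton, h, hr.eq]
        simp
      · intro k hk
        rcases List.mem_append.mp hk with hk | hk
        · exact hω k hk
        · rw [List.mem_singleton.mp hk]; exact hs
    -- Deleting one letter keeps the letters in `I`, and the length drops by exactly one, so the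
    -- word stays reduced.
    · obtain ⟨j, hj, he⟩ := exchange cs (ω := ω) (i := i) (by omega)
      refine ⟨ω.eraseIdx j, ?_, he, fun k hk => hω k (List.mem_of_mem_eraseIdx hk)⟩
      rw [CoxeterSystem.IsReduced, ← he, List.length_eraseIdx_of_lt hj]
      have := hr.eq
      omega
  induction hv using Subgroup.closure_induction_right with
  | one => exact ⟨[], by simp [CoxeterSystem.IsReduced], by simp, by simp⟩
  | mul_right x hx y hy ih => exact step x y hy ih
  | mul_inv_cancel x hx y hy ih =>
    obtain ⟨i, rfl⟩ := hI hy
    rw [cs.inv_simple]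
    exact step x _ hy ih

/-- Write `u = αω` with lengths adding. The descent `i` of `u` deletes a letter of `αω`. It cannot
lie in `ω`, as `ωi` is reduced; so it lies in `α`, and `u` ends in `ωi`. -/
theorem length_mul_inv_wordProd {u : W} (ω : List B) (hω : cs.IsReduced ω)
    (hu : ∀ i ∈ ω, cs.length (u * cs.simple i) < cs.length u) :
    cs.length (u * (cs.wordProd ω)⁻¹) + ω.length = cs.length u := by
  induction ω using List.reverseRecOn with
  | nil => simp
  | append_singleton ω i ih =>
    have hω' : cs.IsReduced ω := by simpa using hω.take ω.length
    have ih := ih hω' fun k hk => hu k (by simp [hk])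
    obtain ⟨α, hα, hαu⟩ := cs.exists_isReduced (u * (cs.wordProd ω)⁻¹)
    have hα' : cs.length (u * (cs.wordProd ω)⁻¹) = α.length := by rw [hαu, hα.eq]
    have hu' : u = cs.wordProd (α ++ ω) := by rw [cs.wordProd_append, ← hαu]; group
    have hi := hu i (by simp)
    obtain ⟨j, hj, he⟩ := exchange cs (ω := α ++ ω) (i := i) (by rwa [← hu'])
    rcases lt_or_ge j α.length with hjα | hjα
    · rw [List.eraseIdx_append_of_lt_length hjα, ← hu', cs.wordProd_append] at he
      have ha : u * (cs.wordProd (ω ++ [i]))⁻¹ = cs.wordProd (α.eraseIdx j) := by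
        rw [cs.wordProd_append, cs.wordProd_singleton, mul_inv_rev, cs.inv_simple, ← mul_assoc,
          he]
        group
      have h1 := cs.length_wordProd_le (α.eraseIdx j)
      rw [List.length_eraseIdx_of_lt hjα] at h1
      have h2 := cs.length_mul_le (u * (cs.wordProd (ω ++ [i]))⁻¹) (cs.wordProd (ω ++ [i]))
      rw [inv_mul_cancel_right, hω.eq, List.length_append, List.length_singleton] at h2
      rw [List.length_append, List.length_singleton]
      rw [ha] at h2 ⊢
      omega
    · rw [List.eraseIdx_append_of_length_le hjα, cs.wordProd_append, cs.wordProd_append,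
        mul_assoc, mul_right_inj] at he
      have h1 := cs.length_wordProd_le (ω.eraseIdx (j - α.length))
      rw [List.length_append] at hj
      rw [List.length_eraseIdx_of_lt (by omega), ← he, ← cs.wordProd_singleton,
        ← cs.wordProd_append, hω.eq, List.length_append, List.length_singleton] at h1
      omega

/-- If every `s ∈ I` is a right descent of `u`, then `ℓ(uv) = ℓ(u) - ℓ(v)` for `v ∈ W_I`. -/
theorem length_mul_add_of_forall_descent {I : Set W} (hI : I ⊆ simples cs) {u v : W}
    (hu : ∀ s ∈ I, cs.length (u * s) < cs.length u) (hv : v ∈ Subgroup.closure I) :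
    cs.length (u * v) + cs.length v = cs.length u := by
  obtain ⟨ω, hr, he, hω⟩ := exists_reduced_word_of_mem_closure cs hI (inv_mem hv)
  have h := length_mul_inv_wordProd cs ω hr fun i hi => hu _ (hω i hi)
  rwa [← he, inv_inv, ← hr.eq, ← he, cs.length_inv] at h

theorem mem_of_mem_closure_of_length_eq_one {I : Set W} (hI : I ⊆ simples cs) {v : W}
    (hv : v ∈ Subgroup.closure I) (h : cs.length v = 1) : v ∈ I := by
  obtain ⟨ω, hr, rfl, hω⟩ := exists_reduced_word_of_mem_closure cs hI hv
  rw [hr.eq, List.length_eq_one_iff] at h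
  obtain ⟨i, rfl⟩ := h
  simpa using hω i

theorem closure_simples : Subgroup.closure (simples cs) = ⊤ := cs.subgroup_closure_range_simple

theorem minReps_anti {I J : Set W} (h : I ⊆ J) : minReps cs J ⊆ minReps cs I :=
  fun _ hx s hs => hx s (h hs)

variable [Finite W]

/-- Maximality makes every `s ∈ I` a right descent of the longest element. -/
theorem length_longest_mul {I : Set W} (hI : I ⊆ simples cs) {v : W}
    (hv : v ∈ Subgroup.closure I) :
    cs.length (longest cs I * v) + cs.length v = cs.length (longest cs I) := by
  refine length_mul_add_of_forall_descent cs hI (fun s hs => ?_) hv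
  have h := length_le_longest cs I (mul_mem (longest_mem cs I) (Subgroup.subset_closure hs))
  obtain ⟨i, rfl⟩ := hI hs
  exact lt_of_le_of_ne h (cs.length_mul_simple_ne _ _)

theorem longest_mul_self {I : Set W} (hI : I ⊆ simples cs) :
    longest cs I * longest cs I = 1 := by
  rw [← cs.length_eq_zero_iff]
  have := length_longest_mul cs hI (longest_mem cs I)
  omega

/-- Uniqueness makes `longest` independent of the choice in its definition, as `longest_conjWo`
requires. -/
theorem eq_longest {I : Set W} (hI : I ⊆ simples cs) {v : W} (hv : v ∈ Subgroup.closure I)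
    (h : cs.length v = cs.length (longest cs I)) : v = longest cs I := by
  have h1 := length_longest_mul cs hI hv
  have h2 : longest cs I * v = 1 := by rw [← cs.length_eq_zero_iff]; omega
  rw [← mul_right_inj (longest cs I), h2, longest_mul_self cs hI]

theorem wo_mul_self : wo cs * wo cs = 1 := longest_mul_self cs subset_rfl

theorem wo_mul_wo_mul (v : W) : wo cs * (wo cs * v) = v := by
  rw [← mul_assoc, wo_mul_self, one_mul]

theorem wo_inv : (wo cs)⁻¹ = wo cs := inv_eq_of_mul_eq_one_left (wo_mul_self cs)

theorem length_wo_mul (v : W) : cs.length (wo cs * v) + cs.length v = cs.length (wo cs) :=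
  length_longest_mul cs subset_rfl (by rw [closure_simples]; trivial)

theorem length_mul_wo (v : W) : cs.length (v * wo cs) + cs.length v = cs.length (wo cs) := by
  rw [← cs.length_inv (v * wo cs), ← cs.length_inv v, mul_inv_rev, wo_inv, length_wo_mul]

theorem length_wo_conj (v : W) : cs.length (wo cs * v * wo cs) = cs.length v := by
  have h1 := length_mul_wo cs (wo cs * v)
  have h2 := length_wo_mul cs v
  omega

/-- Lengths add in the decomposition `W = W^I · W_I`. -/
theorem length_mul_of_mem_minReps {I : Set W} (hI : I ⊆ simples cs) {x v : W}
    (hx : x ∈ minReps cs I) (hv : v ∈ Subgroup.closure I) :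
    cs.length (x * v) = cs.length x + cs.length v := by
  -- Left multiplication by `w∘` turns the ascents of `x` in `I` into descents.
  have h := length_mul_add_of_forall_descent cs hI (u := wo cs * x) (fun s hs => ?_) hv
  · have h1 := length_wo_mul cs x
    have h2 := length_wo_mul cs (x * v)
    rw [← mul_assoc] at h2
    omega
  · have h1 := length_wo_mul cs x
    have h2 := length_wo_mul cs (x * s)
    have h3 := hx s hs
    rw [← mul_assoc] at h2
    omega

/-- The longest element of `xW_I` is `x w_{∘,I}`, and `w∘` reverses lengths, so its translate is the
shortest element of `w∘xW_I`. -/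
theorem wo_mul_mul_longest_mem_minReps {I : Set W} (hI : I ⊆ simples cs) {x : W}
    (hx : x ∈ minReps cs I) : wo cs * x * longest cs I ∈ minReps cs I := by
  intro s hs
  have hs' := Subgroup.subset_closure (k := I) hs
  have hl := longest_mem cs I
  have h1 := length_wo_mul cs (x * longest cs I)
  have h2 := length_wo_mul cs (x * (longest cs I * s))
  rw [length_mul_of_mem_minReps cs hI hx hl] at h1
  rw [length_mul_of_mem_minReps cs hI hx (mul_mem hl hs')] at h2
  have h3 := length_longest_mul cs hI hs'
  have h4 : cs.length s = 1 := by obtain ⟨i, rfl⟩ := hI hs; exact cs.length_simple i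
  simp only [mul_assoc] at *
  omega

theorem conjWo_subset {I : Set W} (hI : I ⊆ simples cs) : conjWo cs I ⊆ simples cs := by
  rintro _ ⟨s, hs, rfl⟩
  obtain ⟨i, rfl⟩ := hI hs
  refine mem_of_mem_closure_of_length_eq_one cs subset_rfl ?_ ?_
  · rw [closure_simples]; trivial
  · simp only [length_wo_conj, cs.length_simple]

theorem wo_conj_mem_minReps {I : Set W} {x : W} (hx : x ∈ minReps cs I) :
    wo cs * x * wo cs ∈ minReps cs (conjWo cs I) := by
  rintro _ ⟨s, hs, rfl⟩
  have h : wo cs * x * wo cs * (wo cs * s * wo cs) = wo cs * (x * s) * wo cs := by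
    simp only [mul_assoc, wo_mul_wo_mul]
  simp only [h, length_wo_conj]
  exact hx s hs

theorem wo_conj_injective : Function.Injective fun g => wo cs * g * wo cs := fun a b h => by
  simpa using h

theorem wo_conj_image_closure (I : Set W) :
    (fun g => wo cs * g * wo cs) '' (Subgroup.closure I : Set W) =
      Subgroup.closure (conjWo cs I) := by
  have e : ((MulAut.conj (wo cs)).toMonoidHom : W → W) = fun g => wo cs * g * wo cs := by
    funext g
    simp [wo_inv]
  have h := congrArg (fun H : Subgroup W => (H : Set W))
    ((MulAut.conj (wo cs)).toMonoidHom.map_closure I)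
  simpa only [Subgroup.coe_map, e, conjWo] using h

/-- Conjugation by `w∘` is a length-preserving bijection between the two parabolic subgroups. -/
theorem longest_conjWo {I : Set W} (hI : I ⊆ simples cs) :
    longest cs (conjWo cs I) = wo cs * longest cs I * wo cs := by
  have key : ∀ {J : Set W} {v : W}, v ∈ Subgroup.closure J →
      wo cs * v * wo cs ∈ Subgroup.closure (conjWo cs J) := fun {J v} hv => by
    have : wo cs * v * wo cs ∈ (Subgroup.closure (conjWo cs J) : Set W) := by
      rw [← wo_conj_image_closure]
      exact ⟨v, hv, rfl⟩
    exact this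
  refine (eq_longest cs (conjWo_subset cs hI) (key (longest_mem cs I)) ?_).symm
  refine le_antisymm (length_le_longest cs _ (key (longest_mem cs I))) ?_
  have h : longest cs (conjWo cs I) ∈ (Subgroup.closure (conjWo cs I) : Set W) :=
    longest_mem cs _
  rw [← wo_conj_image_closure] at h
  obtain ⟨v, hv, hve⟩ := h
  simp only [← hve, length_wo_conj]
  exact length_le_longest cs I hv

end Parabolic

/-! ### The maps on faces and their effect on covers -/

section Maps

variable {B W : Type*} [Group W] {M : CoxeterMatrix B} (cs : CoxeterSystem M W)

theorem face_congr {x y : W} {I J : Set W} {hI : I ⊆ simples cs} {hJ : J ⊆ simples cs}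
    (hIJ : I = J) (h : x⁻¹ * y ∈ Subgroup.closure I) : face cs x I hI = face cs y J hJ := by
  subst hIJ
  exact Subtype.ext ((leftCoset_eq_iff _).mpr h)

variable [Finite W]

/-- Left translation of faces by `w_∘`. -/
noncomputable def leftMulWo (C : CoxeterComplex cs) : CoxeterComplex cs :=
  ⟨wo cs • C.1, by
    obtain ⟨_, I, hI, x, rfl⟩ := C
    exact ⟨I, hI, wo cs * x, by rw [smul_smul]⟩⟩

theorem leftMulWo_face (x : W) (I : Set W) (hI : I ⊆ simples cs) :
    leftMulWo cs (face cs x I hI) = face cs (wo cs * x) I hI :=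
  Subtype.ext (smul_smul _ _ _)

theorem leftMulWo_involutive : Function.Involutive (leftMulWo cs) := fun C =>
  Subtype.ext (by simp [leftMulWo, smul_smul, wo_mul_self])

theorem wo_conj_image_smul (x : W) (I : Set W) :
    (fun g => wo cs * g * wo cs) '' (x • (Subgroup.closure I : Set W)) =
      (wo cs * x * wo cs) • (Subgroup.closure (conjWo cs I) : Set W) := by
  rw [← wo_conj_image_closure, ← Set.image_smul, ← Set.image_smul, Set.image_image,
    Set.image_image]
  refine Set.image_congr' fun g => ?_
  simp only [smul_eq_mul, mul_assoc, wo_mul_wo_mul]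

/-- Conjugation of faces by `w_∘`. -/
noncomputable def conjWoFace (C : CoxeterComplex cs) : CoxeterComplex cs :=
  ⟨(fun g => wo cs * g * wo cs) '' C.1, by
    obtain ⟨_, I, hI, x, rfl⟩ := C
    exact ⟨conjWo cs I, conjWo_subset cs hI, wo cs * x * wo cs, wo_conj_image_smul cs x I⟩⟩

theorem conjWoFace_face (x : W) (I : Set W) (hI : I ⊆ simples cs) :
    conjWoFace cs (face cs x I hI) =
      face cs (wo cs * x * wo cs) (conjWo cs I) (conjWo_subset cs hI) :=
  Subtype.ext (wo_conj_image_smul cs x I)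

theorem conjWoFace_involutive : Function.Involutive (conjWoFace cs) := fun C =>
  Subtype.ext (by
    simp only [conjWoFace, Set.image_image]
    have : ∀ g, wo cs * (wo cs * g * wo cs) * wo cs = g := fun g => by
      simp only [mul_assoc, wo_mul_wo_mul, wo_mul_self, mul_one]
    simp only [this, Set.image_id'])

theorem FacialCover.leftMulWo {C D : CoxeterComplex cs} (h : FacialCover cs C D) :
    FacialCover cs (leftMulWo cs D) (leftMulWo cs C) := by
  cases h with
  | up x I s hI hx hs hsI hxs =>
    have hI' := Set.insert_subset hs hI
    -- The larger coset has minimal representative `w∘ x w_{∘,I∪{s}}`. In the type (2) target the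
    -- two copies of `w_{∘,I∪{s}}` cancel, leaving `w∘xW_I`.
    have h := FacialCover.down (cs := cs) _ _ s hI' (wo_mul_mul_longest_mem_minReps cs hI' hxs)
      (Set.mem_insert s I)
    rw [leftMulWo_face, leftMulWo_face]
    convert! h using 1
    · refine face_congr cs rfl ?_
      rw [inv_mul_cancel_left]
      exact longest_mem cs (insert s I)
    · have e : insert s I \ {s} = I := Set.insert_sdiff_self_of_notMem hsI
      refine face_congr cs e.symm ?_
      rw [mul_assoc (wo cs * x), longest_mul_self cs hI', mul_one, inv_mul_cancel_left, e]
      exact longest_mem cs I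
  | down x I s hI hx hsI =>
    -- With `y = w∘ x w_{∘,I}`, the images are `yW_{I∖{s}}` and `yW_I`; as `y ∈ W^I`, they form a
    -- type (1) cover.
    have hy := wo_mul_mul_longest_mem_minReps cs hI hx
    have e : insert s (I \ {s}) = I := by simp [Set.insert_eq_of_mem hsI]
    have h := FacialCover.up (cs := cs) _ (I \ {s}) s (Set.sdiff_subset.trans hI)
      (minReps_anti cs Set.sdiff_subset hy) (hI hsI) (by simp) (by rwa [e])
    rw [leftMulWo_face, leftMulWo_face]
    convert! h using 1
    · refine face_congr cs rfl ?_
      simpa [mul_assoc] using longest_mem cs (I \ {s})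
    · refine face_congr cs e.symm ?_
      simpa [mul_assoc] using longest_mem cs I

theorem FacialCover.conjWoFace {C D : CoxeterComplex cs} (h : FacialCover cs C D) :
    FacialCover cs (conjWoFace cs C) (conjWoFace cs D) := by
  have hinj := wo_conj_injective cs
  cases h with
  | up x I s hI hx hs hsI hxs =>
    have e : conjWo cs (insert s I) = insert (wo cs * s * wo cs) (conjWo cs I) :=
      Set.image_insert_eq
    have hs' : wo cs * s * wo cs ∉ conjWo cs I := fun hm => hsI (hinj.mem_set_image.mp hm)
    have h := FacialCover.up (cs := cs) _ _ (wo cs * s * wo cs) (conjWo_subset cs hI)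
      (wo_conj_mem_minReps cs hx)
      (conjWo_subset cs (Set.singleton_subset_iff.mpr hs) ⟨s, rfl, rfl⟩) hs'
      (by rw [← e]; exact wo_conj_mem_minReps cs hxs)
    rw [conjWoFace_face, conjWoFace_face]
    convert! h using 1
    exact face_congr cs e (by rw [inv_mul_cancel]; exact one_mem _)
  | down x I s hI hx hsI =>
    have e : conjWo cs (I \ {s}) = conjWo cs I \ {wo cs * s * wo cs} := by
      rw [conjWo, Set.image_sdiff hinj, Set.image_singleton]
      rfl
    have h := FacialCover.down (cs := cs) _ _ (wo cs * s * wo cs) (conjWo_subset cs hI)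
      (wo_conj_mem_minReps cs hx) ⟨s, hsI, rfl⟩
    rw [conjWoFace_face, conjWoFace_face]
    convert! h using 1
    refine face_congr cs e ?_
    rw [← e, longest_conjWo cs hI, longest_conjWo cs (Set.sdiff_subset.trans hI)]
    simp only [mul_assoc, wo_mul_wo_mul, inv_mul_cancel]
    simp

theorem leftMulWo_le {C D : CoxeterComplex cs} (h : C ≤ D) :
    leftMulWo cs D ≤ leftMulWo cs C := by
  induction h with
  | refl => exact le_rfl
  | tail _ hc ih => exact le_trans (Relation.ReflTransGen.single hc.leftMulWo) ih

theorem conjWoFace_le {C D : CoxeterComplex cs} (h : C ≤ D) :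
    conjWoFace cs C ≤ conjWoFace cs D := by
  induction h with
  | refl => exact le_rfl
  | tail _ hc ih => exact le_trans ih (Relation.ReflTransGen.single hc.conjWoFace)

/-- Left translation by `w_∘`, as an anti-automorphism of the facial weak order. -/
noncomputable def leftMulWoIso : CoxeterComplex cs ≃o (CoxeterComplex cs)ᵒᵈ where
  toEquiv := (leftMulWo_involutive cs).toPerm.trans OrderDual.toDual
  map_rel_iff' {C D} := by
    change leftMulWo cs D ≤ leftMulWo cs C ↔ C ≤ D
    refine ⟨fun h => ?_, leftMulWo_le cs⟩
    simpa only [leftMulWo_involutive cs _] using leftMulWo_le cs h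

/-- Conjugation by `w_∘`, as an automorphism of the facial weak order. -/
noncomputable def conjWoIso : CoxeterComplex cs ≃o CoxeterComplex cs where
  toEquiv := (conjWoFace_involutive cs).toPerm
  map_rel_iff' {C D} := by
    refine ⟨fun h => ?_, conjWoFace_le cs⟩
    simpa only [Function.Involutive.coe_toPerm, conjWoFace_involutive cs _] using
      conjWoFace_le cs h

theorem leftMulWoIso_face (x : W) (I : Set W) (hI : I ⊆ simples cs) :
    OrderDual.ofDual (leftMulWoIso cs (face cs x I hI)) =
      face cs (wo cs * x * longest cs I) I hI :=
  (leftMulWo_face cs x I hI).trans (face_congr cs rfl (by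
    rw [inv_mul_cancel_left]; exact longest_mem cs I))

/-- Matches the representative produced by conjugation followed by left translation with the one
stated for the second anti-automorphism. -/
theorem wo_conj_mul_longest_conjWo (x : W) {I : Set W} (hI : I ⊆ simples cs) :
    wo cs * (wo cs * x * wo cs) * longest cs (conjWo cs I) = x * longest cs I * wo cs := by
  simp only [longest_conjWo cs hI, mul_assoc, wo_mul_wo_mul]

end Maps

end FacialWeakOrder

theorem proposition3p7 {B W : Type*} [Group W] [Finite W] {M : CoxeterMatrix B}
    (cs : CoxeterSystem M W) :
    (∃ Φ : FacialWeakOrder.CoxeterComplex cs ≃o (FacialWeakOrder.CoxeterComplex cs)ᵒᵈ,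
      ∀ (I : Set W) (hI : I ⊆ FacialWeakOrder.simples cs),
        ∀ x ∈ FacialWeakOrder.minReps cs I,
          FacialWeakOrder.wo cs * x * FacialWeakOrder.longest cs I
              ∈ FacialWeakOrder.minReps cs I ∧
          OrderDual.ofDual (Φ (FacialWeakOrder.face cs x I hI)) =
            FacialWeakOrder.face cs
              (FacialWeakOrder.wo cs * x * FacialWeakOrder.longest cs I) I hI) ∧
    (∃ Ψ : FacialWeakOrder.CoxeterComplex cs ≃o (FacialWeakOrder.CoxeterComplex cs)ᵒᵈ,
      ∀ (I : Set W) (hI : I ⊆ FacialWeakOrder.simples cs),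
        ∀ x ∈ FacialWeakOrder.minReps cs I,
          ∃ hJ : FacialWeakOrder.conjWo cs I ⊆ FacialWeakOrder.simples cs,
            x * FacialWeakOrder.longest cs I * FacialWeakOrder.wo cs
                ∈ FacialWeakOrder.minReps cs (FacialWeakOrder.conjWo cs I) ∧
            OrderDual.ofDual (Ψ (FacialWeakOrder.face cs x I hI)) =
              FacialWeakOrder.face cs
                (x * FacialWeakOrder.longest cs I * FacialWeakOrder.wo cs)
                (FacialWeakOrder.conjWo cs I) hJ) ∧
    (∃ Θ : FacialWeakOrder.CoxeterComplex cs ≃o FacialWeakOrder.CoxeterComplex cs,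
      ∀ (I : Set W) (hI : I ⊆ FacialWeakOrder.simples cs),
        ∀ x ∈ FacialWeakOrder.minReps cs I,
          ∃ hJ : FacialWeakOrder.conjWo cs I ⊆ FacialWeakOrder.simples cs,
            FacialWeakOrder.wo cs * x * FacialWeakOrder.wo cs
                ∈ FacialWeakOrder.minReps cs (FacialWeakOrder.conjWo cs I) ∧
            Θ (FacialWeakOrder.face cs x I hI) =
              FacialWeakOrder.face cs
                (FacialWeakOrder.wo cs * x * FacialWeakOrder.wo cs)
                (FacialWeakOrder.conjWo cs I) hJ) := by

  refine ⟨⟨FacialWeakOrder.leftMulWoIso cs, fun I hI x hx =>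
      ⟨FacialWeakOrder.wo_mul_mul_longest_mem_minReps cs hI hx,
        FacialWeakOrder.leftMulWoIso_face cs x I hI⟩⟩,
    ⟨(FacialWeakOrder.conjWoIso cs).trans (FacialWeakOrder.leftMulWoIso cs), fun I hI x hx =>
      ⟨FacialWeakOrder.conjWo_subset cs hI, ?_, ?_⟩⟩,
    ⟨FacialWeakOrder.conjWoIso cs, fun I hI x hx =>
      ⟨FacialWeakOrder.conjWo_subset cs hI, FacialWeakOrder.wo_conj_mem_minReps cs hx,
        FacialWeakOrder.conjWoFace_face cs x I hI⟩⟩⟩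
  · rw [← FacialWeakOrder.wo_conj_mul_longest_conjWo cs x hI]
    exact FacialWeakOrder.wo_mul_mul_longest_mem_minReps cs (FacialWeakOrder.conjWo_subset cs hI)
      (FacialWeakOrder.wo_conj_mem_minReps cs hx)
  · simp only [← FacialWeakOrder.wo_conj_mul_longest_conjWo cs x hI]
    rw [← FacialWeakOrder.leftMulWoIso_face, ← FacialWeakOrder.conjWoFace_face]
    rfl
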